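/- For every integer $C_0\ge 0$ and every real $C\ge 0$ there exist constants $C'>0$ and $c>0$, depending only on $C_0$ and $C$, such that the following holds for all $\varepsilon>0$ and all $0<\delta<1$ with $\delta^{\varepsilon}\le c$. Let $\mathcal P$ be a set of at most $\delta^{-1}$ points in the closed unit disk of $\mathbb R^2$ with $|p-q|\ge\delta^{1/2}$ for all distinct $p,q\in\mathcal P$. Let $\mathcal C$ be a finite set of at most $\delta^{-1}$ real algebraic curves of degree at most $C_0$, i.e. sets $\{x\in\mathbb R^2: f(x)=0\}$ with $f\in\mathbb R[x_1,x_2]$ nonconstant of degree at most $C_0$. Let $A\ge 1$, and suppose that for any two distinct points $p,q\in\mathcal P$ there are at most $A$ curves $\gamma\in\mathcal C$ with $\operatorname{dist}(p,\gamma)\le\delta^{1-C\varepsilon}$ and $\operatorname{dist}(q,\gamma)\le\delta^{1-C\varepsilon}$ (with $\operatorname{dist}(p,\emptyset)=\infty$). Then $$\big|\{(p,\gamma)\in\mathcal P\times\mathcal C:\ \operatorname{dist}(p,\gamma)\le\delta^{1-C\varepsilon}\}\big|\ \le\ \delta^{-C'\varepsilon}A^{1/2}\delta^{-4/3}.$$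 -/

import Mathlib

/-- The Euclidean plane. -/
abbrev Plane : Type := EuclideanSpace ℝ (Fin 2)

/-- `γ` is a real algebraic curve of degree at most `D` in the plane: the real zero set of a
nonconstant polynomial of total degree at most `D` (not necessarily irreducible). -/
def IsAlgebraicCurve (D : ℕ) (γ : Set Plane) : Prop :=
  ∃ f : MvPolynomial (Fin 2) ℝ, 1 ≤ f.totalDegree ∧ f.totalDegree ≤ D ∧
    γ = {x : Plane | MvPolynomial.eval (fun i => x i) f = 0}

/-- `dist (p, γ) ≤ r`, where the distance to the empty set is infinite. -/
def IsClose (r : ℝ) (p : Plane) (γ : Set Plane) : Prop :=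
  Metric.infEDist p γ ≤ ENNReal.ofReal r

/-- The number of pairs `(p, γ) ∈ P × 𝒞` with `dist (p, γ) ≤ r`. -/
noncomputable def numClosePairs (r : ℝ) (P : Finset Plane) (𝒞 : Finset (Set Plane)) : ℕ :=
  {x : Plane × Set Plane | x.1 ∈ P ∧ x.2 ∈ 𝒞 ∧ IsClose r x.1 x.2}.ncard

/-- The number of curves `γ ∈ 𝒞` with `dist (p, γ) ≤ r` and `dist (q, γ) ≤ r`. -/
noncomputable def numCommonCurves (r : ℝ) (𝒞 : Finset (Set Plane)) (p q : Plane) : ℕ :=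
  {γ : Set Plane | γ ∈ 𝒞 ∧ IsClose r p γ ∧ IsClose r q γ}.ncard

/-! Cover the disk by lattice cells of scale `s = δ^(1/3)`. A curve of bounded degree meets only
`O(1/s)` of them (`card_metCells_le`), so there are `O(δ⁻¹/s) = O(δ^(-4/3))` pairs (curve, cell).
Cauchy–Schwarz over these pairs (`sq_card_incidences_le`) bounds `I²`, for `I` incidences, by this
number times the count of triples (p, q, γ) with both points close to γ and in the same cell. The
diagonal contributes `I`. By separation a cell holds `O(s²/δ) = O(1/s)` points, so the rest
contributes `O(A δ⁻¹/s)`. Thus `I² ≲ δ^(-4/3) (I + A δ^(-4/3))`, which gives `I ≲ A^(1/2) δ^(-4/3)`.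

The cell count is by induction on the degree: a zero set meeting a cell either crosses its boundary,
which is controlled by roots on grid lines, or forces a zero of a partial derivative inside. -/

/-! ### Bivariate polynomials: derivatives, critical points, restriction to lines. -/

theorem MvPolynomial.hasDerivAt_eval_update {σ : Type*} [DecidableEq σ] (f : MvPolynomial σ ℝ)
    (y : σ → ℝ) (i : σ) (t : ℝ) :
    HasDerivAt (fun t => MvPolynomial.eval (Function.update y i t) f)
      (MvPolynomial.eval (Function.update y i t) (MvPolynomial.pderiv i f)) t := by
  induction f using MvPolynomial.induction_on with
  | C a => simpa using hasDerivAt_const t a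
  | add p q hp hq =>
    simp only [map_add]
    exact hp.add hq
  | mul_X p j hp =>
    have hX : HasDerivAt (fun t => Function.update y i t j)
        (MvPolynomial.eval (Function.update y i t) (MvPolynomial.pderiv i (MvPolynomial.X j))) t := by
      by_cases h : j = i
      · subst h; simpa using hasDerivAt_id' t
      · simpa [MvPolynomial.pderiv_X, h, Pi.single_apply] using hasDerivAt_const t (y j)
    have := hp.mul hX
    simp only [MvPolynomial.pderiv_mul, map_add, map_mul, MvPolynomial.eval_X]
    exact this

theorem MvPolynomial.totalDegree_pderiv_le {σ R : Type*} [CommSemiring R] (f : MvPolynomial σ R)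
    (i : σ) : (MvPolynomial.pderiv i f).totalDegree ≤ f.totalDegree - 1 := by
  classical
  rw [MvPolynomial.totalDegree, Finset.sup_le_iff]
  intro m hm
  rw [MvPolynomial.mem_support_iff, MvPolynomial.coeff_pderiv] at hm
  have h : m + Finsupp.single i 1 ∈ f.support :=
    MvPolynomial.mem_support_iff.2 fun h0 => hm (by simp [h0])
  have := MvPolynomial.le_totalDegree h
  rw [Finsupp.sum_add_index' (by simp) (by simp)] at this
  simp at this
  omega

open Metric in
/-- A zero set meeting a box but not its boundary forces a critical point inside the box. -/
theorem exists_pderiv_eq_zero_of_sphere_ne_zero (f : MvPolynomial (Fin 2) ℝ) (c x : Fin 2 → ℝ)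
    (R : ℝ) (hx : x ∈ closedBall c R) (hfx : MvPolynomial.eval x f = 0)
    (hs : ∀ z ∈ sphere c R, MvPolynomial.eval z f ≠ 0) (i : Fin 2) :
    ∃ y ∈ closedBall c R, MvPolynomial.eval y (MvPolynomial.pderiv i f) = 0 := by
  have key : ∀ g : MvPolynomial (Fin 2) ℝ, MvPolynomial.eval x g = 0 →
      (∀ z ∈ sphere c R, 0 < MvPolynomial.eval z g) →
      ∃ y ∈ closedBall c R, MvPolynomial.eval y (MvPolynomial.pderiv i g) = 0 := by
    intro g hg hpos
    obtain ⟨y, hy, hmin⟩ := exists_isLocalMin_mem_ball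
      (f := fun z : Fin 2 → ℝ => MvPolynomial.eval z g)
      (MvPolynomial.continuous_eval g).continuousOn hx (fun z hz => by simpa [hg] using hpos z hz)
    refine ⟨y, ball_subset_closedBall hy, ?_⟩
    have hmin' : IsLocalMin (fun z : Fin 2 → ℝ => MvPolynomial.eval z g)
        (Function.update y i (y i)) := by rwa [Function.update_eq_self]
    have h1 := IsLocalMin.comp_continuous (g := fun t => Function.update y i t) (b := y i) hmin'
      (by fun_prop)
    simpa using h1.hasDerivAt_eq_zero (MvPolynomial.hasDerivAt_eval_update g y i (y i))
  -- The boundary is connected, so `f` has constant sign on it; up to replacing `f` by `-f` it is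
  -- positive there, and the zero `x` forces an interior minimum.
  have hconn : IsPreconnected (sphere c R) :=
    isPreconnected_sphere (by rw [rank_fin_fun]; norm_num) c R
  by_cases hneg : ∃ z ∈ sphere c R, MvPolynomial.eval z f < 0
  · obtain ⟨z, hz, hz0⟩ := hneg
    obtain ⟨y, hy, h⟩ := key (-f) (by simpa using hfx) (by
      intro w hw
      by_contra hcon
      obtain ⟨v, hv, hv0⟩ := hconn.intermediate_value hz hw
        (f := fun z : Fin 2 → ℝ => MvPolynomial.eval z f)
        (MvPolynomial.continuous_eval f).continuousOn
        (show (0 : ℝ) ∈ Set.Icc _ _ from ⟨hz0.le, by simpa using hcon⟩)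
      exact hs v hv hv0)
    exact ⟨y, hy, by simpa using h⟩
  · push Not at hneg
    exact key f hfx fun z hz => lt_of_le_of_ne (hneg z hz) (hs z hz).symm

/-- The restriction of `f` to the line `x i = a`. -/
noncomputable def lineRestrict (f : MvPolynomial (Fin 2) ℝ) (i : Fin 2) (a : ℝ) : Polynomial ℝ :=
  MvPolynomial.aeval (fun l => if l = i then Polynomial.C a else Polynomial.X) f

theorem eval_aeval_polynomial (f : MvPolynomial (Fin 2) ℝ) (g : Fin 2 → Polynomial ℝ) (t : ℝ) :
    (MvPolynomial.aeval g f).eval t = MvPolynomial.eval (fun l => (g l).eval t) f := by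
  induction f using MvPolynomial.induction_on with
  | C a => simp
  | add p q hp hq => simp [hp, hq]
  | mul_X p j hp => simp [hp]

theorem natDegree_aeval_le_totalDegree (f : MvPolynomial (Fin 2) ℝ) (g : Fin 2 → Polynomial ℝ)
    (hg : ∀ l, (g l).natDegree ≤ 1) : (MvPolynomial.aeval g f).natDegree ≤ f.totalDegree := by
  simpa using MvPolynomial.aeval_natDegree_le f le_rfl g hg

theorem eval_lineRestrict (f : MvPolynomial (Fin 2) ℝ) (i : Fin 2) (x : Fin 2 → ℝ) :
    (lineRestrict f i (x i)).eval (x (1 - i)) = MvPolynomial.eval x f := by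
  rw [lineRestrict, eval_aeval_polynomial]
  congr 2
  funext l
  fin_cases i <;> fin_cases l <;> simp

theorem natDegree_lineRestrict_le (f : MvPolynomial (Fin 2) ℝ) (i : Fin 2) (a : ℝ) :
    (lineRestrict f i a).natDegree ≤ f.totalDegree := by
  refine natDegree_aeval_le_totalDegree f _ fun l => ?_
  split_ifs <;> simp

/-- A nonzero polynomial vanishes identically on few lines parallel to a coordinate axis. -/
theorem exists_finset_lineRestrict_ne_zero (f : MvPolynomial (Fin 2) ℝ) (hf : f ≠ 0) (i : Fin 2) :
    ∃ Z : Finset ℝ, Z.card ≤ f.totalDegree ∧ ∀ a, lineRestrict f i a = 0 → a ∈ Z := by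
  obtain ⟨b, hb⟩ : ∃ b, MvPolynomial.eval b f ≠ 0 := by
    by_contra h
    push Not at h
    exact hf (MvPolynomial.funext fun x => by simpa using h x)
  set q : Polynomial ℝ := MvPolynomial.aeval
    (fun l => if l = i then Polynomial.X else Polynomial.C (b l)) f with hq
  have hqe : ∀ a, q.eval a = MvPolynomial.eval (Function.update b i a) f := by
    intro a
    rw [hq, eval_aeval_polynomial]
    congr 2
    funext l
    by_cases h : l = i
    · subst h; simp
    · simp [h]
  have hq0 : q ≠ 0 := fun h => hb (by simpa [h] using (hqe (b i)).symm)
  refine ⟨q.roots.toFinset, ?_, fun a ha => ?_⟩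
  · refine (Multiset.toFinset_card_le _).trans ((Polynomial.card_roots' q).trans ?_)
    refine natDegree_aeval_le_totalDegree f _ fun l => ?_
    split_ifs <;> simp
  · rw [Multiset.mem_toFinset, Polynomial.mem_roots hq0, Polynomial.IsRoot, hqe]
    have := eval_lineRestrict f i (Function.update b i a)
    rw [Function.update_self, ha] at this
    simpa using this.symm

/-! ### Counting the cells met by an algebraic curve. -/

/-- The lattice box `{-M, …, M}²`. -/
noncomputable def latticeBox (M : ℕ) : Finset (Fin 2 → ℤ) :=
  Fintype.piFinset fun _ => Finset.Icc (-(M : ℤ)) M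

theorem mem_latticeBox {M : ℕ} {k : Fin 2 → ℤ} :
    k ∈ latticeBox M ↔ ∀ i, k i ∈ Finset.Icc (-(M : ℤ)) M := by
  simp [latticeBox]

/-- The cell with centre `s k` and side `2 s`. -/
def latticeCell (s : ℝ) (k : Fin 2 → ℤ) : Set (Fin 2 → ℝ) :=
  Metric.closedBall (fun i => s * (k i : ℝ)) s

open Classical in
/-- The cells of a lattice box that meet a zero set. -/
noncomputable def metCells (s : ℝ) (M : ℕ) (f : MvPolynomial (Fin 2) ℝ) : Finset (Fin 2 → ℤ) :=
  (latticeBox M).filter fun k => ∃ x ∈ latticeCell s k, MvPolynomial.eval x f = 0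

open Classical in
/-- The cells of a lattice box with a side `x i = s (k i + σ)` that meets a zero set. -/
noncomputable def metSides (s : ℝ) (M : ℕ) (f : MvPolynomial (Fin 2) ℝ) (i : Fin 2) (σ : ℤ) :
    Finset (Fin 2 → ℤ) :=
  (latticeBox M).filter fun k =>
    ∃ x ∈ latticeCell s k, x i = s * ((k i + σ : ℤ) : ℝ) ∧ MvPolynomial.eval x f = 0

theorem exists_finset_card_le_three_of_abs_sub_le (s : ℝ) (hs : 0 < s) (t : ℝ) :
    ∃ J : Finset ℤ, J.card ≤ 3 ∧ ∀ k : ℤ, |t - s * k| ≤ s → k ∈ J := by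
  refine ⟨Finset.Icc ⌈t / s - 1⌉ ⌊t / s + 1⌋, ?_, fun k hk => ?_⟩
  · rw [Int.card_Icc]
    have h1 := Int.floor_le (t / s + 1)
    have h2 := Int.le_ceil (t / s - 1)
    have h3 : (⌊t / s + 1⌋ : ℝ) ≤ ⌈t / s - 1⌉ + 2 := by linarith
    have h4 : ⌊t / s + 1⌋ ≤ ⌈t / s - 1⌉ + 2 := by exact_mod_cast h3
    omega
  · rw [abs_le] at hk
    rw [Finset.mem_Icc, Int.ceil_le, Int.le_floor, sub_le_iff_le_add, div_le_iff₀ hs,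
      ← sub_le_iff_le_add, le_div_iff₀ hs]
    constructor <;> nlinarith

/-- At most `deg f` grid lines lie in the zero set, and each accounts for at most `2 M + 1` cells
(`D ×ˢ I`). On every other line there are at most `deg f` roots, each touching at most 3 cells
(`G`). -/
theorem card_metSides_le (s : ℝ) (hs : 0 < s) (M : ℕ) (f : MvPolynomial (Fin 2) ℝ) (hf : f ≠ 0)
    (i : Fin 2) (σ : ℤ) :
    (metSides s M f i σ).card ≤ 4 * f.totalDegree * (2 * M + 1) := by
  classical
  obtain ⟨Z, hZ, hZ'⟩ := exists_finset_lineRestrict_ne_zero f hf i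
  choose J hJ hJ' using exists_finset_card_le_three_of_abs_sub_le s hs
  set I : Finset ℤ := Finset.Icc (-(M : ℤ)) M with hI
  have hIc : I.card = 2 * M + 1 := by rw [hI, Int.card_Icc]; omega
  let mk : ℤ × ℤ → Fin 2 → ℤ := fun ab l => if l = i then ab.1 else ab.2
  have hmk : ∀ k : Fin 2 → ℤ, mk (k i, k (1 - i)) = k := by
    intro k
    funext l
    fin_cases i <;> fin_cases l <;> simp [mk]
  let D : Finset ℤ := Z.biUnion fun z => I.filter fun a => s * ((a + σ : ℤ) : ℝ) = z
  have hD : D.card ≤ f.totalDegree := by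
    refine (Finset.card_biUnion_le_card_mul _ _ 1 fun z _ => ?_).trans (by simpa using hZ)
    rw [Finset.card_le_one]
    intro a ha b hb
    rw [Finset.mem_filter] at ha hb
    have := mul_left_cancel₀ hs.ne' (ha.2.trans hb.2.symm)
    have := Int.cast_injective this
    omega
  let G : Finset (ℤ × ℤ) := I.biUnion fun a =>
    (lineRestrict f i (s * ((a + σ : ℤ) : ℝ))).roots.toFinset.biUnion fun t => (J t).image (a, ·)
  have hG : G.card ≤ (2 * M + 1) * (f.totalDegree * 3) := by
    rw [← hIc]
    refine Finset.card_biUnion_le_card_mul _ _ _ fun a _ => ?_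
    refine (Finset.card_biUnion_le_card_mul _ _ 3 fun t _ =>
      Finset.card_image_le.trans (hJ t)).trans ?_
    gcongr
    exact (Multiset.toFinset_card_le _).trans
      ((Polynomial.card_roots' _).trans (natDegree_lineRestrict_le f i _))
  have hsub : metSides s M f i σ ⊆ (D ×ˢ I ∪ G).image mk := by
    intro k hk
    rw [metSides, Finset.mem_filter, mem_latticeBox] at hk
    obtain ⟨hkM, x, hx, hxi, hfx⟩ := hk
    refine Finset.mem_image.2 ⟨(k i, k (1 - i)), ?_, hmk k⟩
    rw [Finset.mem_union]
    by_cases h0 : lineRestrict f i (s * ((k i + σ : ℤ) : ℝ)) = 0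
    · left
      rw [Finset.mem_product]
      refine ⟨Finset.mem_biUnion.2 ⟨_, hZ' _ h0, Finset.mem_filter.2 ⟨hkM i, rfl⟩⟩, hkM _⟩
    · right
      refine Finset.mem_biUnion.2 ⟨k i, hkM i, Finset.mem_biUnion.2 ⟨x (1 - i), ?_,
        Finset.mem_image_of_mem _ (hJ' _ _ ?_)⟩⟩
      · rw [Multiset.mem_toFinset, Polynomial.mem_roots h0, Polynomial.IsRoot, ← hxi,
          eval_lineRestrict, hfx]
      · have := (dist_le_pi_dist x _ (1 - i)).trans hx
        rwa [Real.dist_eq] at this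
  calc (metSides s M f i σ).card ≤ (D ×ˢ I ∪ G).card :=
        (Finset.card_le_card hsub).trans Finset.card_image_le
    _ ≤ D.card * I.card + G.card := by
        rw [← Finset.card_product]; exact Finset.card_union_le _ _
    _ ≤ f.totalDegree * (2 * M + 1) + (2 * M + 1) * (f.totalDegree * 3) := by
        rw [hIc]; gcongr
    _ = _ := by ring

theorem exists_mem_side_of_mem_sphere {s : ℝ} (hs : 0 < s) {k : Fin 2 → ℤ} {x : Fin 2 → ℝ}
    (hx : x ∈ Metric.sphere (fun i => s * (k i : ℝ)) s) :
    ∃ i : Fin 2, ∃ σ ∈ ({-1, 1} : Finset ℤ), x i = s * ((k i + σ : ℤ) : ℝ) := by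
  obtain ⟨i, hi⟩ : ∃ i, dist (x i) (s * (k i : ℝ)) = s := by
    by_contra! h
    have hlt : dist x (fun i => s * (k i : ℝ)) < s := (dist_pi_lt_iff hs).2 fun i =>
      lt_of_le_of_ne ((dist_le_pi_dist x _ i).trans (Metric.mem_sphere.1 hx).le) (h i)
    exact hlt.ne hx
  rw [Real.dist_eq] at hi
  refine ⟨i, ?_⟩
  rcases (abs_eq hs.le).1 hi with h | h
  · exact ⟨1, by simp, by push_cast; linarith⟩
  · exact ⟨-1, by simp, by push_cast; linarith⟩

/-- An algebraic curve of degree `d` meets `O(d² M)` of the `(2 M + 1)²` cells of a box. -/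
theorem card_metCells_le (s : ℝ) (hs : 0 < s) (M d : ℕ) (f : MvPolynomial (Fin 2) ℝ) (hf : f ≠ 0)
    (hd : f.totalDegree ≤ d) : (metCells s M f).card ≤ 16 * d ^ 2 * (2 * M + 1) := by
  classical
  induction d generalizing f with
  | zero =>
    obtain ⟨a, rfl⟩ : ∃ a, f = MvPolynomial.C a :=
      ⟨_, MvPolynomial.totalDegree_eq_zero_iff_eq_C.1 (Nat.le_zero.1 hd)⟩
    have ha : a ≠ 0 := by rintro rfl; simp at hf
    simp [metCells, ha]
  | succ d ih =>
    let B : Finset (Fin 2 → ℤ) := (Finset.univ : Finset (Fin 2)).biUnion fun i =>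
      ({-1, 1} : Finset ℤ).biUnion fun σ => metSides s M f i σ
    have hB : B.card ≤ 16 * (d + 1) * (2 * M + 1) := by
      have h1 : B.card ≤ 2 * (2 * (4 * f.totalDegree * (2 * M + 1))) := by
        refine Finset.card_biUnion_le_card_mul _ _ _ fun i _ => ?_
        exact Finset.card_biUnion_le_card_mul _ _ _ fun σ _ => card_metSides_le s hs M f hf i σ
      refine h1.trans ?_
      calc 2 * (2 * (4 * f.totalDegree * (2 * M + 1))) = 16 * f.totalDegree * (2 * M + 1) := by ring
        _ ≤ _ := by gcongr
    have hmem : ∀ k ∈ latticeBox M, ∀ x ∈ Metric.sphere (fun i => s * (k i : ℝ)) s,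
        MvPolynomial.eval x f = 0 → k ∈ B := by
      intro k hk x hx hfx
      obtain ⟨i, σ, hσ, hxi⟩ := exists_mem_side_of_mem_sphere hs hx
      exact Finset.mem_biUnion.2 ⟨i, Finset.mem_univ _, Finset.mem_biUnion.2 ⟨σ, hσ,
        Finset.mem_filter.2 ⟨hk, x, Metric.sphere_subset_closedBall hx, hxi, hfx⟩⟩⟩
    -- The induction hypothesis needs a nonzero derivative. If it vanishes, `f` is constant in
    -- direction 0, and any zero in a cell slides to the side of that cell.
    by_cases h0 : MvPolynomial.pderiv 0 f = 0
    · have hsub : metCells s M f ⊆ B := by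
        intro k hk
        obtain ⟨hk, x, hx, hfx⟩ := Finset.mem_filter.1 hk
        refine hmem k hk (Function.update x 0 (s * (k 0 : ℝ) + s)) ?_ ?_
        · have hle := (dist_pi_le_iff hs.le).1 hx
          refine le_antisymm ((dist_pi_le_iff hs.le).2 fun l => ?_) ?_
          · by_cases hl : l = 0
            · subst hl; simp [abs_of_pos hs]
            · simpa [hl] using hle l
          · refine le_trans ?_ (dist_le_pi_dist _ _ 0)
            simp [abs_of_pos hs]
        · have hd : ∀ t, HasDerivAt (fun t => MvPolynomial.eval (Function.update x 0 t) f) 0 t := by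
            intro t
            simpa [h0] using MvPolynomial.hasDerivAt_eval_update f x 0 t
          have := is_const_of_deriv_eq_zero (fun t => (hd t).differentiableAt)
            (fun t => (hd t).deriv) (s * (k 0 : ℝ) + s) (x 0)
          simpa [hfx] using this
      calc (metCells s M f).card ≤ _ := (Finset.card_le_card hsub).trans hB
        _ ≤ _ := by gcongr; nlinarith
    · have hsub : metCells s M f ⊆ B ∪ metCells s M (MvPolynomial.pderiv 0 f) := by
        intro k hk
        obtain ⟨hk, x, hx, hfx⟩ := Finset.mem_filter.1 hk
        rw [Finset.mem_union]
        by_cases hz : ∃ z ∈ Metric.sphere (fun i => s * (k i : ℝ)) s, MvPolynomial.eval z f = 0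
        · obtain ⟨z, hz, hz0⟩ := hz
          exact .inl (hmem k hk z hz hz0)
        · push Not at hz
          exact .inr (Finset.mem_filter.2
            ⟨hk, exists_pderiv_eq_zero_of_sphere_ne_zero f _ x s hx hfx hz 0⟩)
      have hdeg := MvPolynomial.totalDegree_pderiv_le f 0
      calc (metCells s M f).card ≤ 16 * (d + 1) * (2 * M + 1) + 16 * d ^ 2 * (2 * M + 1) :=
            (Finset.card_le_card hsub).trans ((Finset.card_union_le _ _).trans
              (add_le_add hB (ih _ h0 (by omega))))
        _ = 16 * (d + 1 + d ^ 2) * (2 * M + 1) := by ring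
        _ ≤ _ := by gcongr; nlinarith

/-! ### Cauchy–Schwarz over pairs of a curve and a cell. -/

open Classical in
/-- Cauchy–Schwarz bound for the number of incidences of a relation `R` whose points are
distributed over cells, where `S` contains the pairs of a curve and a cell it is incident to. -/
theorem sq_card_incidences_le {α β κ : Type*} (P : Finset α) (Γ : Finset β) (R : α → β → Prop)
    (cell : α → κ) (S : Finset (β × κ)) (A m : ℝ) (hA : 0 ≤ A)
    (hS : ∀ p ∈ P, ∀ γ ∈ Γ, R p γ → (γ, cell p) ∈ S)
    (hpair : ∀ p ∈ P, ∀ q ∈ P, p ≠ q → ((Γ.filter fun γ => R p γ ∧ R q γ).card : ℝ) ≤ A)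
    (hcell : ∀ p ∈ P, ((P.filter fun q => cell q = cell p).card : ℝ) ≤ m) :
    (((P ×ˢ Γ).filter fun x => R x.1 x.2).card : ℝ) ^ 2 ≤
      S.card * (((P ×ˢ Γ).filter fun x => R x.1 x.2).card + P.card * (m * A)) := by
  set T := (P ×ˢ Γ).filter fun x => R x.1 x.2 with hT
  let φ : α × β → β × κ := fun x => (x.2, cell x.1)
  have hφ : ∀ t ∈ T, φ t ∈ S := by
    intro t ht
    obtain ⟨h, hR⟩ := Finset.mem_filter.1 ht
    obtain ⟨h1, h2⟩ := Finset.mem_product.1 h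
    exact hS _ h1 _ h2 hR
  let N : α → Finset α := fun p => P.filter fun q => cell q = cell p ∧ p ≠ q
  have h1 : (T.card : ℝ) ^ 2 ≤ S.card * ∑ b ∈ S, ((T.filter fun t => φ t = b).card : ℝ) ^ 2 := by
    rw [Finset.card_eq_sum_card_fiberwise hφ, Nat.cast_sum]
    exact sq_sum_le_card_mul_sum_sq
  -- The sum of squares counts ordered pairs of incidences sharing curve and cell; below, the
  -- diagonal supplies the 1 in `h3`, and `h4` counts the rest over pairs of points.
  have h2 : ∑ b ∈ S, ((T.filter fun t => φ t = b).card : ℝ) ^ 2 =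
      ∑ t ∈ T, ((T.filter fun t' => φ t' = φ t).card : ℝ) := by
    rw [← Finset.sum_fiberwise_of_maps_to hφ]
    refine Finset.sum_congr rfl fun b _ => ?_
    rw [Finset.sum_congr rfl (g := fun _ => ((T.filter fun t => φ t = b).card : ℝ))]
    · rw [Finset.sum_const, nsmul_eq_mul, sq]
    · intro t ht
      rw [(Finset.mem_filter.1 ht).2]
  have h3 : ∀ t ∈ T, ((T.filter fun t' => φ t' = φ t).card : ℝ) ≤
      1 + ((N t.1).filter fun q => R q t.2).card := by
    intro t _
    have : (T.filter fun t' => φ t' = φ t).card ≤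
        (insert t.1 ((N t.1).filter fun q => R q t.2)).card := by
      refine Finset.card_le_card_of_injOn Prod.fst ?_ ?_
      · intro t' ht'
        obtain ⟨ht', hφ'⟩ := Finset.mem_filter.1 ht'
        obtain ⟨h, hR⟩ := Finset.mem_filter.1 ht'
        simp only [φ, Prod.mk.injEq] at hφ'
        rw [Finset.mem_coe, Finset.mem_insert]
        by_cases he : t'.1 = t.1
        · exact .inl he
        · refine .inr (Finset.mem_filter.2 ⟨Finset.mem_filter.2
            ⟨(Finset.mem_product.1 h).1, hφ'.2, Ne.symm he⟩, ?_⟩)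
          rwa [← hφ'.1]
      · intro t₁ h₁ t₂ h₂ he
        have e₁ := (Finset.mem_filter.1 h₁).2
        have e₂ := (Finset.mem_filter.1 h₂).2
        simp only [φ, Prod.mk.injEq] at e₁ e₂
        exact Prod.ext he (e₁.1.trans e₂.1.symm)
    have := this.trans (Finset.card_insert_le _ _)
    rw [add_comm]
    exact_mod_cast this
  have h4 : ∑ t ∈ T, (((N t.1).filter fun q => R q t.2).card : ℝ) ≤ P.card * (m * A) := by
    rw [hT, Finset.sum_filter, Finset.sum_product, ← nsmul_eq_mul]
    refine Finset.sum_le_card_nsmul _ _ _ fun p hp => ?_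
    have : ∑ γ ∈ Γ, (if R p γ then (((N p).filter fun q => R q γ).card : ℝ) else 0) =
        ∑ q ∈ N p, ((Γ.filter fun γ => R p γ ∧ R q γ).card : ℝ) := by
      simp only [Finset.card_filter, Nat.cast_sum]
      rw [Finset.sum_comm]
      refine Finset.sum_congr rfl fun γ _ => ?_
      by_cases h : R p γ <;> simp [h]
    rw [this]
    refine (Finset.sum_le_card_nsmul _ _ A fun q hq => ?_).trans ?_
    · obtain ⟨hq, _, hne⟩ := Finset.mem_filter.1 hq
      exact hpair p hp q hq hne
    · rw [nsmul_eq_mul]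
      refine mul_le_mul_of_nonneg_right (le_trans ?_ (hcell p hp)) hA
      exact_mod_cast Finset.card_le_card fun q hq => by
        obtain ⟨h, h', _⟩ := Finset.mem_filter.1 hq
        exact Finset.mem_filter.2 ⟨h, h'⟩
  refine h1.trans (mul_le_mul_of_nonneg_left ?_ (Nat.cast_nonneg _))
  rw [h2]
  refine (Finset.sum_le_sum h3).trans ?_
  rw [Finset.sum_add_distrib, Finset.sum_const, nsmul_eq_mul, mul_one]
  linarith

/-! ### Points in cells, and curves close to them. -/

/-- The index of a lattice cell containing `p`. -/
noncomputable def cellIndex (s : ℝ) (p : Plane) : Fin 2 → ℤ := fun i => round (p i / s)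

theorem abs_sub_cellIndex_le {s : ℝ} (hs : 0 < s) (p : Plane) (i : Fin 2) :
    |p i - s * cellIndex s p i| ≤ s / 2 := by
  have h := abs_sub_round (p i / s)
  have : p i - s * cellIndex s p i = s * (p i / s - round (p i / s)) := by
    rw [cellIndex]; field_simp
  rw [this, abs_mul, abs_of_pos hs]
  nlinarith

theorem abs_apply_sub_apply_le_dist (p q : Plane) (i : Fin 2) : |p i - q i| ≤ dist p q := by
  rw [dist_eq_norm, ← Real.norm_eq_abs]
  exact PiLp.norm_apply_le (p - q) i

theorem cellIndex_mem_latticeBox {s : ℝ} (hs : 0 < s) {p : Plane}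
    (hp : p ∈ Metric.closedBall (0 : Plane) 1) : cellIndex s p ∈ latticeBox ⌈1 / s⌉₊ := by
  rw [mem_latticeBox]
  intro i
  have h1 : |p i| ≤ 1 := by
    simpa using (abs_apply_sub_apply_le_dist p 0 i).trans hp
  have h2 := abs_le.1 (abs_sub_round (p i / s))
  have h3 : |p i / s| ≤ ⌈1 / s⌉₊ := by
    rw [abs_div, abs_of_pos hs]
    exact (div_le_div_of_nonneg_right h1 hs.le).trans (Nat.le_ceil _)
  rw [abs_le] at h3
  rw [Finset.mem_Icc]
  have h4 : (round (p i / s) : ℝ) < (⌈1 / s⌉₊ : ℝ) + 1 := by linarith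
  have h5 : -(⌈1 / s⌉₊ : ℝ) - 1 < (round (p i / s) : ℝ) := by linarith
  have h4' : round (p i / s) < (⌈1 / s⌉₊ : ℤ) + 1 := by exact_mod_cast h4
  have h5' : -(⌈1 / s⌉₊ : ℤ) - 1 < round (p i / s) := by exact_mod_cast h5
  rw [cellIndex]
  constructor <;> omega

open Classical in
/-- A cell of side `s` contains `O((s / ρ)²)` points with mutual distances at least `ρ`. -/
theorem card_filter_cellIndex_le {s ρ : ℝ} (hρ : 0 < ρ) (hρs : ρ ≤ s) (P : Finset Plane)
    (hP : ∀ p ∈ P, ∀ q ∈ P, p ≠ q → ρ ≤ dist p q) (k : Fin 2 → ℤ) :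
    ((P.filter fun q => cellIndex s q = k).card : ℝ) ≤ 16 * (s / ρ) ^ 2 := by
  have hs : 0 < s := hρ.trans_le hρs
  have hη : 0 < ρ / 2 := by positivity
  let lo : Fin 2 → ℤ := fun i => ⌈(s * k i - s / 2) / (ρ / 2) - 1 / 2⌉
  let hi : Fin 2 → ℤ := fun i => ⌊(s * k i + s / 2) / (ρ / 2) + 1 / 2⌋
  have hcard : ∀ i, ((Finset.Icc (lo i) (hi i)).card : ℝ) ≤ 4 * (s / ρ) := by
    intro i
    have h1 := Int.floor_le ((s * k i + s / 2) / (ρ / 2) + 1 / 2)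
    have h2 := Int.le_ceil ((s * k i - s / 2) / (ρ / 2) - 1 / 2)
    have h3 : (s * k i + s / 2) / (ρ / 2) - (s * k i - s / 2) / (ρ / 2) = 2 * (s / ρ) := by
      field_simp; ring
    have h4 : 1 ≤ s / ρ := by rwa [le_div_iff₀ hρ, one_mul]
    rw [Int.card_Icc]
    rcases le_total 0 (hi i + 1 - lo i) with h | h
    · have h5 : (((hi i + 1 - lo i).toNat : ℤ) : ℝ) = ((hi i + 1 - lo i : ℤ) : ℝ) := by
        rw [Int.toNat_of_nonneg h]
      rw [Int.cast_natCast] at h5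
      rw [h5]
      push_cast
      simp only [lo, hi]
      linarith
    · rw [Int.toNat_of_nonpos h]
      simp only [Nat.cast_zero]
      positivity
  have hle : (P.filter fun q => cellIndex s q = k).card ≤
      (Fintype.piFinset fun i => Finset.Icc (lo i) (hi i)).card := by
    -- Rounding to the mesh `ρ / 2` is injective: points with the same index differ by at most `ρ /
    -- 2` in each coordinate, so their distance is at most `ρ / √2 < ρ`.
    refine Finset.card_le_card_of_injOn (cellIndex (ρ / 2)) ?_ ?_
    · intro q hq
      have hqk := (Finset.mem_filter.1 hq).2
      rw [Finset.mem_coe, Fintype.mem_piFinset]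
      intro i
      have h1 := abs_le.1 (abs_sub_cellIndex_le hs q i)
      rw [hqk] at h1
      have h2 := abs_le.1 (abs_sub_round (q i / (ρ / 2)))
      have h3 : (s * k i - s / 2) / (ρ / 2) ≤ q i / (ρ / 2) :=
        div_le_div_of_nonneg_right (by linarith) hη.le
      have h4 : q i / (ρ / 2) ≤ (s * k i + s / 2) / (ρ / 2) :=
        div_le_div_of_nonneg_right (by linarith) hη.le
      rw [Finset.mem_Icc, Int.ceil_le, Int.le_floor, cellIndex]
      constructor <;> linarith
    · intro p hp q hq he
      by_contra hne
      have h1 := hP p (Finset.mem_filter.1 hp).1 q (Finset.mem_filter.1 hq).1 hne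
      have h2 : ∀ i, |p i - q i| ≤ ρ / 2 := by
        intro i
        have hpi := abs_le.1 (abs_sub_cellIndex_le hη p i)
        have hqi := abs_le.1 (abs_sub_cellIndex_le hη q i)
        rw [he] at hpi
        rw [abs_le]
        constructor <;> linarith
      have h3 : dist p q ^ 2 ≤ ρ ^ 2 / 2 := by
        rw [EuclideanSpace.dist_sq_eq, Fin.sum_univ_two, Real.dist_eq, Real.dist_eq]
        have := pow_le_pow_left₀ (abs_nonneg _) (h2 0) 2
        have := pow_le_pow_left₀ (abs_nonneg _) (h2 1) 2
        linarith
      nlinarith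
  calc ((P.filter fun q => cellIndex s q = k).card : ℝ)
      ≤ (Finset.Icc (lo 0) (hi 0)).card * (Finset.Icc (lo 1) (hi 1)).card := by
        rw [Fintype.card_piFinset, Fin.prod_univ_two] at hle
        exact_mod_cast hle
    _ ≤ (4 * (s / ρ)) * (4 * (s / ρ)) :=
        mul_le_mul (hcard 0) (hcard 1) (Nat.cast_nonneg _) (by positivity)
    _ = _ := by ring

/-- A curve close to a point meets the cell of that point. -/
theorem exists_mem_latticeCell_of_isClose {r s : ℝ} (hs : 0 < s) (hrs : r < s / 2) {p : Plane}
    {γ : Set Plane} (h : IsClose r p γ) :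
    ∃ x ∈ γ, (fun i => x i) ∈ latticeCell s (cellIndex s p) := by
  have h1 : Metric.infEDist p γ < ENNReal.ofReal (s / 2) :=
    lt_of_le_of_lt h ((ENNReal.ofReal_lt_ofReal_iff (by positivity)).2 hrs)
  obtain ⟨x, hx, hpx⟩ := Metric.infEDist_lt_iff.1 h1
  rw [edist_dist, ENNReal.ofReal_lt_ofReal_iff (by positivity)] at hpx
  refine ⟨x, hx, (dist_pi_le_iff hs.le).2 fun i => ?_⟩
  -- Rounding moves `p` by at most `s / 2` per coordinate and `x` is within `s / 2` of `p`; this is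
  -- why cells have radius `s` and overlap.
  have h2 := abs_le.1 (abs_apply_sub_apply_le_dist p x i)
  have h3 := abs_le.1 (abs_sub_cellIndex_le hs p i)
  rw [Real.dist_eq, abs_le]
  constructor <;> linarith

open Classical in
/-- The pairs of a curve and a lattice cell it meets. -/
noncomputable def meetingPairs (s : ℝ) (M : ℕ) (Γ : Finset (Set Plane)) :
    Finset (Set Plane × (Fin 2 → ℤ)) :=
  (Γ ×ˢ latticeBox M).filter fun x => ∃ y ∈ x.1, (fun i => y i) ∈ latticeCell s x.2

theorem card_meetingPairs_le {s : ℝ} (hs : 0 < s) (M D : ℕ) (Γ : Finset (Set Plane))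
    (hΓ : ∀ γ ∈ Γ, IsAlgebraicCurve D γ) :
    (meetingPairs s M Γ).card ≤ Γ.card * (16 * D ^ 2 * (2 * M + 1)) := by
  classical
  have : meetingPairs s M Γ ⊆ Γ.biUnion fun γ => ((latticeBox M).filter fun k =>
      ∃ y ∈ γ, (fun i => y i) ∈ latticeCell s k).image (γ, ·) := by
    rintro ⟨γ, k⟩ h
    obtain ⟨h, h'⟩ := Finset.mem_filter.1 h
    obtain ⟨h1, h2⟩ := Finset.mem_product.1 h
    exact Finset.mem_biUnion.2 ⟨γ, h1, Finset.mem_image_of_mem _ (Finset.mem_filter.2 ⟨h2, h'⟩)⟩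
  refine (Finset.card_le_card this).trans (Finset.card_biUnion_le_card_mul _ _ _ fun γ hγ => ?_)
  obtain ⟨f, hf1, hfD, rfl⟩ := hΓ γ hγ
  refine Finset.card_image_le.trans (le_trans (Finset.card_le_card fun k hk => ?_)
    (card_metCells_le s hs M D f (by rintro rfl; simp at hf1) hfD))
  obtain ⟨hk, y, hy, hy'⟩ := Finset.mem_filter.1 hk
  exact Finset.mem_filter.2 ⟨hk, _, hy', hy⟩

/-! ### Assembling the incidence bound. -/

open Classical in
theorem numClosePairs_eq_card (r : ℝ) (P : Finset Plane) (Γ : Finset (Set Plane)) :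
    numClosePairs r P Γ = ((P ×ˢ Γ).filter fun x => IsClose r x.1 x.2).card := by
  rw [numClosePairs, ← Set.ncard_coe_finset]
  congr 1
  ext x
  simp [and_assoc]

open Classical in
theorem numCommonCurves_eq_card (r : ℝ) (Γ : Finset (Set Plane)) (p q : Plane) :
    numCommonCurves r Γ p q = (Γ.filter fun γ => IsClose r p γ ∧ IsClose r q γ).card := by
  rw [numCommonCurves, ← Set.ncard_coe_finset]
  congr 1
  ext x
  simp

theorem numClosePairs_le_card_mul_card (r : ℝ) (P : Finset Plane) (Γ : Finset (Set Plane)) :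
    numClosePairs r P Γ ≤ P.card * Γ.card := by
  classical
  rw [numClosePairs_eq_card, ← Finset.card_product]
  exact Finset.card_filter_le _ _

/-- If `x > 2 K B L`, the two terms on the right of `h` are at most `x² / 2` and `x² / 4`, a
contradiction. -/
theorem le_of_sq_le_mul_add {x K L B : ℝ} (hK : 0 ≤ K) (hL : 0 ≤ L) (hB : 1 ≤ B)
    (h : x ^ 2 ≤ K * L * (x + K * B ^ 2 * L)) : x ≤ 2 * K * B * L := by
  by_contra! hx
  have h0 : 0 ≤ K * L := mul_nonneg hK hL
  have h1 : K * L ≤ K * B * L := by nlinarith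
  have h2 : 0 < x := lt_of_le_of_lt (by positivity) hx
  nlinarith

/-- The incidence bound for a radius that is small compared with the side `δ ^ (1 / 3)`. -/
theorem numClosePairs_le_of_lt (D : ℕ) {δ r : ℝ} (hδ : 0 < δ) (hδ1 : δ < 1)
    (hr : r < δ ^ (1 / 3 : ℝ) / 2) (P : Finset Plane) (Γ : Finset (Set Plane)) (A : ℝ) (hA : 1 ≤ A)
    (hP : ∀ p ∈ P, p ∈ Metric.closedBall (0 : Plane) 1) (hPc : (P.card : ℝ) ≤ δ⁻¹)
    (hPd : ∀ p ∈ P, ∀ q ∈ P, p ≠ q → δ ^ (1 / 2 : ℝ) ≤ dist p q)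
    (hΓ : ∀ γ ∈ Γ, IsAlgebraicCurve D γ) (hΓc : (Γ.card : ℝ) ≤ δ⁻¹)
    (hpair : ∀ p ∈ P, ∀ q ∈ P, p ≠ q → (numCommonCurves r Γ p q : ℝ) ≤ A) :
    (numClosePairs r P Γ : ℝ) ≤
      2 * (80 * D ^ 2 + 16) * A ^ (1 / 2 : ℝ) * δ ^ (-(4 / 3) : ℝ) := by
  classical
  -- For a general scale the two terms give `I ≲ δ⁻¹/s` and `I ≲ A^(1/2) δ^(-3/2) s^(1/2)`; up to
  -- the factor in `A` they balance at this exponent.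
  set s := δ ^ (1 / 3 : ℝ) with hs_def
  have hs : 0 < s := Real.rpow_pos_of_pos hδ _
  have hs1 : s ≤ 1 := Real.rpow_le_one hδ.le hδ1.le (by norm_num)
  have hρ : 0 < δ ^ (1 / 2 : ℝ) := Real.rpow_pos_of_pos hδ _
  have hρs : δ ^ (1 / 2 : ℝ) ≤ s :=
    Real.rpow_le_rpow_of_exponent_ge hδ hδ1.le (by norm_num)
  set L := δ ^ (-(4 / 3) : ℝ) with hL_def
  have hL : 0 < L := Real.rpow_pos_of_pos hδ _
  have hLs : δ⁻¹ * (1 / s) = L := by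
    rw [hs_def, one_div, ← Real.rpow_neg hδ.le, ← Real.rpow_neg_one, ← Real.rpow_add hδ]
    norm_num [hL_def]
  have hsρ : (s / δ ^ (1 / 2 : ℝ)) ^ 2 = 1 / s := by
    rw [hs_def, one_div (δ ^ _), ← Real.rpow_sub hδ, ← Real.rpow_natCast, ← Real.rpow_mul hδ.le,
      ← Real.rpow_neg hδ.le]
    norm_num
  set M := ⌈1 / s⌉₊ with hM_def
  have hM : (2 * M + 1 : ℝ) ≤ 5 * (1 / s) := by
    have h1 : (M : ℝ) < 1 / s + 1 := Nat.ceil_lt_add_one (by positivity)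
    have h2 : 1 ≤ 1 / s := by rwa [le_div_iff₀ hs, one_mul]
    linarith
  have hS : ((meetingPairs s M Γ).card : ℝ) ≤ 80 * D ^ 2 * L := by
    have h := card_meetingPairs_le hs M D Γ hΓ
    calc ((meetingPairs s M Γ).card : ℝ) ≤ Γ.card * (16 * D ^ 2 * (2 * M + 1)) := by
          exact_mod_cast h
      _ ≤ δ⁻¹ * (16 * D ^ 2 * (5 * (1 / s))) := by gcongr
      _ = 80 * D ^ 2 * (δ⁻¹ * (1 / s)) := by ring
      _ = _ := by rw [hLs]
  have hmain := sq_card_incidences_le P Γ (IsClose r) (cellIndex s) (meetingPairs s M Γ) A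
    (16 * (1 / s)) (by linarith) ?_ ?_ ?_
  · rw [← numClosePairs_eq_card] at hmain
    refine le_of_sq_le_mul_add (by positivity) hL.le (Real.one_le_rpow hA (by norm_num)) ?_
    have hA2 : (A ^ (1 / 2 : ℝ)) ^ 2 = A := by
      rw [← Real.sqrt_eq_rpow, Real.sq_sqrt (by linarith)]
    rw [hA2]
    have hA0 : 0 ≤ A := by linarith
    refine hmain.trans (mul_le_mul (hS.trans ?_) ?_ (by positivity) (by positivity))
    · gcongr; linarith
    · refine add_le_add_right ?_ _
      calc (P.card : ℝ) * (16 * (1 / s) * A) ≤ δ⁻¹ * (16 * (1 / s) * A) := by gcongr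
        _ = 16 * A * (δ⁻¹ * (1 / s)) := by ring
        _ = 16 * A * L := by rw [hLs]
        _ ≤ _ := by gcongr; nlinarith [sq_nonneg (D : ℝ)]
  · intro p hp γ hγ h
    exact Finset.mem_filter.2 ⟨Finset.mem_product.2 ⟨hγ, cellIndex_mem_latticeBox hs (hP p hp)⟩,
      exists_mem_latticeCell_of_isClose hs hr h⟩
  · intro p hp q hq hne
    have := hpair p hp q hq hne
    rwa [numCommonCurves_eq_card] at this
  · intro p _
    rw [← hsρ]
    convert card_filter_cellIndex_le hρ hρs P hPd _

theorem lemma6p16 (C₀ : ℕ) (C : ℝ) (hC : 0 ≤ C) :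
    ∃ C' : ℝ, ∃ c : ℝ, 0 < C' ∧ 0 < c ∧
      ∀ (ε δ : ℝ), 0 < ε → 0 < δ → δ < 1 → δ ^ ε ≤ c →
      ∀ (P : Finset Plane) (𝒞 : Finset (Set Plane)) (A : ℝ), 1 ≤ A →
        (∀ p ∈ P, p ∈ Metric.closedBall (0 : Plane) 1) →
        (P.card : ℝ) ≤ δ⁻¹ →
        (∀ p ∈ P, ∀ q ∈ P, p ≠ q → δ ^ (1 / 2 : ℝ) ≤ dist p q) →
        (∀ γ ∈ 𝒞, IsAlgebraicCurve C₀ γ) →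
        (𝒞.card : ℝ) ≤ δ⁻¹ →
        (∀ p ∈ P, ∀ q ∈ P, p ≠ q →
          (numCommonCurves (δ ^ (1 - C * ε)) 𝒞 p q : ℝ) ≤ A) →
        (numClosePairs (δ ^ (1 - C * ε)) P 𝒞 : ℝ) ≤
          δ ^ (-(C' * ε)) * (A ^ (1 / 2 : ℝ) * δ ^ (-(4 / 3) : ℝ)) := by
  set K : ℝ := 2 * (80 * C₀ ^ 2 + 16) with hK_def
  have hK : 32 ≤ K := by
    rw [hK_def]; nlinarith [sq_nonneg (C₀ : ℝ)]
  -- With `c = 1 / K`, one factor `δ^(-ε)` absorbs the constant `K`. The 2 in `C'` makes `δ^(-C'ε) ≥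
  -- δ^(-2/3)` once `(C + 1) ε ≥ 1/3`, so the trivial bound `δ⁻²` suffices there.
  refine ⟨2 * (C + 1), 1 / K, by positivity, by positivity, ?_⟩
  intro ε δ hε hδ hδ1 hc P Γ A hA hP hPc hPd hΓ hΓc hpair
  have hA' : 1 ≤ A ^ (1 / 2 : ℝ) := Real.one_le_rpow hA (by norm_num)
  have hL : 0 < δ ^ (-(4 / 3) : ℝ) := Real.rpow_pos_of_pos hδ _
  rcases le_or_gt (1 / 3) ((C + 1) * ε) with hbig | hsmall
  · calc (numClosePairs (δ ^ (1 - C * ε)) P Γ : ℝ) ≤ P.card * Γ.card := by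
          exact_mod_cast numClosePairs_le_card_mul_card _ P Γ
      _ ≤ δ⁻¹ * δ⁻¹ := by gcongr
      _ = δ ^ (-(2 / 3) : ℝ) * (1 * δ ^ (-(4 / 3) : ℝ)) := by
          rw [one_mul, ← Real.rpow_add hδ, ← Real.rpow_neg_one, ← Real.rpow_add hδ]
          norm_num
      _ ≤ _ := by
          have := Real.rpow_le_rpow_of_exponent_ge hδ hδ1.le
            (show -(2 * (C + 1) * ε) ≤ -(2 / 3) by linarith)
          gcongr
  -- Here `ε < 1/3` gives `s ≤ δ^ε ≤ 1/32` for `s = δ^(1/3)`, and `C ε < 1/3` makes the radius at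
  -- most `s²`, hence below `s / 2`.
  · have hCε : 0 ≤ C * ε := by positivity
    have hs2 : δ ^ (1 / 3 : ℝ) ≤ 1 / 32 :=
      (Real.rpow_le_rpow_of_exponent_ge hδ hδ1.le (by linarith)).trans
        (hc.trans (one_div_le_one_div_of_le (by norm_num) hK))
    have hs : 0 < δ ^ (1 / 3 : ℝ) := Real.rpow_pos_of_pos hδ _
    have hr : δ ^ (1 - C * ε) < δ ^ (1 / 3 : ℝ) / 2 := by
      calc δ ^ (1 - C * ε) ≤ δ ^ (1 / 3 + 1 / 3 : ℝ) :=
            Real.rpow_le_rpow_of_exponent_ge hδ hδ1.le (by linarith)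
        _ = δ ^ (1 / 3 : ℝ) * δ ^ (1 / 3 : ℝ) := Real.rpow_add hδ _ _
        _ < _ := by nlinarith
    refine (numClosePairs_le_of_lt C₀ hδ hδ1 hr P Γ A hA hP hPc hPd hΓ hΓc hpair).trans ?_
    rw [← hK_def, mul_assoc]
    gcongr
    calc K ≤ (δ ^ ε)⁻¹ := by
          rw [le_inv_comm₀ (by linarith) (Real.rpow_pos_of_pos hδ _), ← one_div]
          exact hc
      _ = δ ^ (-ε) := (Real.rpow_neg hδ.le _).symm
      _ ≤ _ := Real.rpow_le_rpow_of_exponent_ge hδ hδ1.le (by nlinarith)
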